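/- Let $B$ be the braid group of the complex reflection group $G_{26}$, that is, the group with generators $s_1,s_2,t$ and relations $ts_2ts_2=s_2ts_2t$, $s_2s_1s_2=s_1s_2s_1$, $ts_1=s_1t$. Let $R=\mathbf{Z}[a,b,c,c^{-1},d,e,e^{-1}]$, and let $\hat A$ be the generic Hecke algebra of $G_{26}$, that is, the quotient of the group algebra $RB$ by the relations $s_i^3=as_i^2+bs_i+c$ ($i=1,2$) and $t^2=dt+e$. Let $A_3=\langle s_1,s_2\rangle\subset\hat A$ be the $R$-subalgebra generated by $s_1,s_2$ (the parabolic subalgebra of type $G_4$). Then there are elements $x_1=1,x_2,\dots,x_{24}$ of the subgroup of $B$ generated by $s_1,s_2$ and elements $y_1=1,y_2,\dots,y_{54}$ of $B$ such that the images of $y_1,\dots,y_{54}$ generate $\hat A$ as a left $A_3$-module, and the images of $x_1,\dots,x_{24}$ span $A_3$ as an $R$-module. Consequently $\hat A$ is spanned as an $R$-module by the images of the $24\cdot 54=1296$ elements $x_iy_j$ of $B$, among which is $1$. -/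

import Mathlib

namespace G26

/-- The three standard generators of the braid group of `G_26`. -/
inductive Gen
  | s1
  | s2
  | t

/-- The defining relators of the braid group of `G_26`:
`t s₂ t s₂ = s₂ t s₂ t`, `s₂ s₁ s₂ = s₁ s₂ s₁`, `t s₁ = s₁ t`. -/
def braidRelators : Set (FreeGroup Gen) :=
  let s1 := FreeGroup.of Gen.s1
  let s2 := FreeGroup.of Gen.s2
  let t := FreeGroup.of Gen.t
  {(t * s2 * t * s2) * (s2 * t * s2 * t)⁻¹,
   (s2 * s1 * s2) * (s1 * s2 * s1)⁻¹,
   (t * s1) * (s1 * t)⁻¹}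

/-- The braid group `B` of `G_26`. -/
abbrev Braid : Type := PresentedGroup braidRelators

/-- The image of a generator in the braid group. -/
def gen (g : Gen) : Braid := PresentedGroup.of g

/-- The Hecke relations in the group algebra `k B`:
`s_i ^ 3 = a s_i ^ 2 + b s_i + c` for `i = 1, 2`, and `t ^ 2 = d t + e`. -/
inductive HeckeRel (k : Type) [CommRing k] (a b c d e : k) :
    MonoidAlgebra k Braid → MonoidAlgebra k Braid → Prop
  | s1 : HeckeRel k a b c d e
      (MonoidAlgebra.of k Braid (gen Gen.s1) ^ 3)
      (a • MonoidAlgebra.of k Braid (gen Gen.s1) ^ 2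
        + b • MonoidAlgebra.of k Braid (gen Gen.s1) + c • 1)
  | s2 : HeckeRel k a b c d e
      (MonoidAlgebra.of k Braid (gen Gen.s2) ^ 3)
      (a • MonoidAlgebra.of k Braid (gen Gen.s2) ^ 2
        + b • MonoidAlgebra.of k Braid (gen Gen.s2) + c • 1)
  | t : HeckeRel k a b c d e
      (MonoidAlgebra.of k Braid (gen Gen.t) ^ 2)
      (d • MonoidAlgebra.of k Braid (gen Gen.t) + e • 1)

/-- The Hecke algebra of `G_26` over `k` with parameters `a, b, c, d, e`: the quotient of the
group algebra of the braid group by the two-sided ideal generated by the Hecke relations. -/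
abbrev Hecke (k : Type) [CommRing k] (a b c d e : k) : Type :=
  RingQuot (HeckeRel k a b c d e)

/-- The natural map from the braid group to the Hecke algebra. -/
noncomputable def ofBraid (k : Type) [CommRing k] (a b c d e : k) :
    Braid →* Hecke k a b c d e :=
  ((RingQuot.mkAlgHom k (HeckeRel k a b c d e)) :
    MonoidAlgebra k Braid →* Hecke k a b c d e).comp (MonoidAlgebra.of k Braid)

/-- Names of the five indeterminates. -/
inductive Param
  | a
  | b
  | c
  | d
  | e

/-- The generic ring of parameters `R = ℤ[a, b, c, c⁻¹, d, e, e⁻¹]`. -/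
abbrev R : Type :=
  Localization.Away
    (MvPolynomial.X Param.c * MvPolynomial.X Param.e : MvPolynomial Param ℤ)

/-- An indeterminate, as an element of `R`. -/
noncomputable def param (p : Param) : R :=
  algebraMap (MvPolynomial Param ℤ) R (MvPolynomial.X p)

/-- The generic Hecke algebra `Â` of `G_26`, over `R`. -/
abbrev GenericHecke : Type :=
  Hecke R (param Param.a) (param Param.b) (param Param.c) (param Param.d) (param Param.e)

/-- The natural map `B → Â`. -/
noncomputable def toHecke : Braid →* GenericHecke :=
  ofBraid R (param Param.a) (param Param.b) (param Param.c) (param Param.d) (param Param.e)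

/-- The parabolic subalgebra `A₃ = ⟨s₁, s₂⟩` of `Â`. -/
noncomputable def A3 : Subalgebra R GenericHecke :=
  Algebra.adjoin R {toHecke (gen Gen.s1), toHecke (gen Gen.s2)}

end G26

/-! Linear algebra is replaced by bookkeeping of memberships. Fix a submodule M. Since c and e are
units, the Hecke relations are recurrences that run both ways: if p x^k q maps into M for two
consecutive k (x = t) or three (x = s₁, s₂), it does so for every k. This is `LineClosed`. No
coefficient is ever computed. What remains is a list of equalities of braids, checked by word
reversing.

Write H = ⟨s₁, s₂⟩ and ζ = (t s₂ s₁)³, which is central. The centre of G₂₆ has order 6, and modulo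
it the group is the union of H and HtH. As t commutes with s₁, the left H-cosets in HtH are reached
by t v, with v among 8 representatives of ⟨s₁⟩ \ G₄. Hence 54 = 6·(1 + 8) and 24 = 3·8. The claim to
prove is that a predicate closed under lines and under H on both sides, and true on ζ^k H t^i H for
-2 ≤ k ≤ 3, is true on all braids (`Saturated.forall_braid`).

Elements with two runs of t reduce to t s₂ t, t s₂⁻¹ t and t s₂ s₁² s₂ t (`holds_two`), which follow
from elements with one run at nearby powers of ζ. Six consecutive powers of ζ yield the preceding
one (`holds_pred`), and the automorphism inverting the generators yields the following one, so all
powers are reached. Multiplying one run by t on the right then gives nothing new, and induction on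
the braid finishes. -/

namespace G26

/-! ### Words in the braid group and a sound test for equality -/

/-- Letters of braid words: `a`, `b`, `t` stand for `s₁`, `s₂`, `t` and capitals for inverses. -/
inductive Letter
  | a
  | b
  | t
  | A
  | B
  | T
  deriving DecidableEq

/-- A word in the generators of the braid group and their inverses. -/
abbrev Word : Type := List Letter

namespace Letter

/-- The braid represented by a letter. -/
def eval : Letter → Braid
  | a => gen Gen.s1
  | b => gen Gen.s2
  | t => gen Gen.t
  | A => (gen Gen.s1)⁻¹
  | B => (gen Gen.s2)⁻¹
  | T => (gen Gen.t)⁻¹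

/-- The inverse letter. -/
def inv : Letter → Letter
  | a => A
  | b => B
  | t => T
  | A => a
  | B => b
  | T => t

theorem eval_inv (x : Letter) : x.inv.eval = x.eval⁻¹ := by
  cases x <;> simp [inv, eval]

/-- Whether a letter belongs to the parabolic subgroup `⟨s₁, s₂⟩`. -/
def inParabolic : Letter → Bool
  | t => false
  | T => false
  | _ => true

/-- Whether a letter is one of the generators. -/
def isPos : Letter → Bool
  | a => true
  | b => true
  | t => true
  | _ => false

/-- For an inverse letter `x` and a generator `y`, a word equal to `x y` of the form
(positive word) * (negative word), obtained from the braid relations. -/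
def complement : Letter → Letter → Option Word
  | A, a => some []
  | A, b => some [b, a, B, A]
  | A, t => some [t, A]
  | B, a => some [a, b, A, B]
  | B, b => some []
  | B, t => some [t, b, t, B, T, B]
  | T, a => some [a, T]
  | T, b => some [b, t, b, T, B, T]
  | T, t => some []
  | _, _ => none

end Letter

open Letter

theorem gen_t_mul_s2 :
    gen Gen.t * gen Gen.s2 * gen Gen.t * gen Gen.s2 =
      gen Gen.s2 * gen Gen.t * gen Gen.s2 * gen Gen.t := by
  refine mul_inv_eq_one.mp ?_
  have h := PresentedGroup.one_of_mem (rels := braidRelators)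
    (x := (FreeGroup.of Gen.t * FreeGroup.of Gen.s2 * FreeGroup.of Gen.t * FreeGroup.of Gen.s2) *
      (FreeGroup.of Gen.s2 * FreeGroup.of Gen.t * FreeGroup.of Gen.s2 * FreeGroup.of Gen.t)⁻¹)
    (by simp [braidRelators])
  exact h

theorem gen_s2_mul_s1 :
    gen Gen.s2 * gen Gen.s1 * gen Gen.s2 = gen Gen.s1 * gen Gen.s2 * gen Gen.s1 := by
  refine mul_inv_eq_one.mp ?_
  have h := PresentedGroup.one_of_mem (rels := braidRelators)
    (x := (FreeGroup.of Gen.s2 * FreeGroup.of Gen.s1 * FreeGroup.of Gen.s2) *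
      (FreeGroup.of Gen.s1 * FreeGroup.of Gen.s2 * FreeGroup.of Gen.s1)⁻¹)
    (by simp [braidRelators])
  exact h

theorem gen_t_mul_s1 : gen Gen.t * gen Gen.s1 = gen Gen.s1 * gen Gen.t := by
  refine mul_inv_eq_one.mp ?_
  have h := PresentedGroup.one_of_mem (rels := braidRelators)
    (x := (FreeGroup.of Gen.t * FreeGroup.of Gen.s1) *
      (FreeGroup.of Gen.s1 * FreeGroup.of Gen.t)⁻¹)
    (by simp [braidRelators])
  exact h

namespace Word

/-- The braid represented by a word. -/
def eval (w : Word) : Braid := (w.map Letter.eval).prod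

@[simp]
theorem eval_nil : eval [] = 1 := rfl

@[simp]
theorem eval_cons (x : Letter) (w : Word) : eval (x :: w) = x.eval * eval w := by
  simp [eval]

@[simp]
theorem eval_append (v w : Word) : eval (v ++ w) = eval v * eval w := by
  simp [eval]

/-- The inverse word. -/
def inv (w : Word) : Word := (w.map Letter.inv).reverse

theorem eval_inv (w : Word) : eval (inv w) = (eval w)⁻¹ := by
  induction w with
  | nil => simp [inv]
  | cons x w ih =>
    have : inv (x :: w) = inv w ++ [x.inv] := by simp [inv]
    simp [this, ih, Letter.eval_inv]

theorem eval_complement {x y : Letter} {w : Word} (h : complement x y = some w) :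
    eval w = x.eval * y.eval := by
  have h1 := gen_t_mul_s2
  have h2 := gen_s2_mul_s1
  have h3 := gen_t_mul_s1
  cases x <;> cases y <;> simp only [complement, Option.some.injEq, reduceCtorEq] at h <;>
    subst h <;> simp only [eval_cons, eval_nil, Letter.eval, mul_one, inv_mul_cancel] <;>
    rw [eq_inv_mul_iff_mul_eq] <;> simp only [← mul_assoc, mul_inv_eq_iff_eq_mul] <;>
    simp only [h1, h2, h3]

/-- Word reversing: eliminate every subword (inverse letter)(generator) by `complement`. The first
list holds the letters already treated, in reverse order. -/
def reversing : ℕ → Word → Word → Word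
  | 0, u, w => u.reverse ++ w
  | _ + 1, u, [] => u.reverse
  | n + 1, [], y :: w => reversing n [y] w
  | n + 1, x :: u, y :: w =>
    match complement x y with
    | some c => reversing n u (c ++ w)
    | none => reversing n (y :: x :: u) w

theorem eval_reversing (n : ℕ) (u w : Word) :
    eval (reversing n u w) = eval u.reverse * eval w := by
  induction n generalizing u w with
  | zero => simp [reversing]
  | succ n ih =>
    match u, w with
    | u, [] => simp [reversing]
    | [], y :: w => simp [reversing, ih]
    | x :: u, y :: w =>
      rw [reversing]
      split
      · next c hc => simp [ih, eval_complement hc, mul_assoc]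
      · simp [ih, mul_assoc]

/-- A sound test for a word to represent the trivial braid. -/
def isTrivial (w : Word) : Bool :=
  let v := reversing 100000 [] w
  (reversing 100000 [] (v.filter (fun x => !x.isPos) ++ v.filter isPos)).isEmpty &&
    (v == v.filter isPos ++ v.filter (fun x => !x.isPos))

/-- Reversing brings the word to the form P N, with P positive and N negative. Now P N = 1 iff N P =
1, and N P can be reversed again, this time to the empty word. Each reversing step preserves the
braid, so the step bound 100000 cannot harm soundness. -/
theorem eval_eq_one_of_isTrivial {w : Word} (h : isTrivial w = true) : eval w = 1 := by
  simp only [isTrivial, Bool.and_eq_true, List.isEmpty_iff, beq_iff_eq] at h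
  obtain ⟨h1, h2⟩ := h
  have h3 := eval_reversing 100000 [] w
  have h4 := congrArg eval h1
  rw [eval_reversing] at h4
  rw [h2] at h3
  simp only [List.reverse_nil, eval_nil, one_mul, eval_append] at h3 h4
  rw [← h3]
  exact mul_eq_one_comm.mp h4

/-- A sound test for two words to represent the same braid. -/
def equiv (v w : Word) : Bool := isTrivial (v ++ inv w)

theorem eval_eq_of_equiv {v w : Word} (h : equiv v w = true) : eval v = eval w := by
  have := eval_eq_one_of_isTrivial h
  rw [eval_append, eval_inv] at this
  exact mul_inv_eq_one.mp this

end Word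

/-! ### Powers of letters, the central element, the inversion automorphism -/

namespace Word

/-- The word `x ^ k`. -/
def pow (x : Letter) : ℤ → Word
  | .ofNat n => List.replicate n x
  | .negSucc n => List.replicate (n + 1) x.inv

@[simp]
theorem eval_pow (x : Letter) (k : ℤ) : eval (pow x k) = x.eval ^ k := by
  cases k with
  | ofNat n => simp [pow, eval]
  | negSucc n => simp [pow, eval, Letter.eval_inv, zpow_negSucc]

/-- The word `(t s₂ s₁)³`, whose braid generates the centre. -/
def center : Word := [t, b, a, t, b, a, t, b, a]

/-- The word of the `k`-th power of the central element. -/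
def centerPow : ℤ → Word
  | .ofNat n => (List.replicate n center).flatten
  | .negSucc n => (List.replicate (n + 1) (inv center)).flatten

end Word

/-- The central element `(t s₂ s₁)³` of the braid group. -/
def zeta : Braid := Word.eval Word.center

namespace Word

theorem eval_flatten_replicate (n : ℕ) (w : Word) :
    eval (List.replicate n w).flatten = eval w ^ n := by
  induction n with
  | zero => simp
  | succ n ih => simp [List.replicate_succ, ih, pow_succ']

@[simp]
theorem eval_centerPow (k : ℤ) : eval (centerPow k) = zeta ^ k := by
  cases k with
  | ofNat n => simp [centerPow, eval_flatten_replicate, zeta]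
  | negSucc n => simp [centerPow, eval_flatten_replicate, zeta, eval_inv, zpow_negSucc]

end Word

/-- The parabolic subgroup `⟨s₁, s₂⟩`. -/
abbrev parabolic : Subgroup Braid := Subgroup.closure {gen Gen.s1, gen Gen.s2}

theorem Letter.eval_a_mem : Letter.eval a ∈ parabolic :=
  Subgroup.subset_closure (by simp [Letter.eval])

theorem Letter.eval_b_mem : Letter.eval b ∈ parabolic :=
  Subgroup.subset_closure (by simp [Letter.eval])

theorem Letter.eval_mem_parabolic {x : Letter} (h : x.inParabolic = true) :
    x.eval ∈ parabolic := by
  cases x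
  · exact eval_a_mem
  · exact eval_b_mem
  · simp [inParabolic] at h
  · exact inv_mem eval_a_mem
  · exact inv_mem eval_b_mem
  · simp [inParabolic] at h

theorem Word.eval_mem_parabolic {w : Word} (h : w.all inParabolic = true) :
    w.eval ∈ parabolic := by
  induction w with
  | nil => exact one_mem _
  | cons x w ih =>
    simp only [List.all_cons, Bool.and_eq_true] at h
    rw [Word.eval_cons]
    exact mul_mem (Letter.eval_mem_parabolic h.1) (ih h.2)

/-- Induction on braids by right multiplication by generators and their inverses. -/
theorem braid_induction {p : Braid → Prop} (x : Braid) (one : p 1)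
    (step : ∀ y, p y → ∀ l : Letter, p (y * l.eval)) : p x := by
  have hx : x ∈ Subgroup.closure (Set.range (gen : Gen → Braid)) := by
    have : Subgroup.closure (Set.range (gen : Gen → Braid)) = ⊤ :=
      PresentedGroup.closure_range_of braidRelators
    rw [this]; trivial
  induction hx using Subgroup.closure_induction_right with
  | one => exact one
  | mul_right y _ g hg ih =>
    obtain ⟨g, rfl⟩ := hg
    cases g
    · exact step y ih a
    · exact step y ih b
    · exact step y ih t
  | mul_inv_cancel y _ g hg ih =>
    obtain ⟨g, rfl⟩ := hg
    cases g
    · exact step y ih A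
    · exact step y ih B
    · exact step y ih T

theorem zeta_comm (x : Braid) : Commute zeta x := by
  induction x using braid_induction with
  | one => exact Commute.one_right _
  | step y hy l =>
    refine hy.mul_right ?_
    have key : ∀ l : Letter, Word.equiv (Word.center ++ [l]) ([l] ++ Word.center) = true := by
      intro l; cases l <;> decide +kernel
    have := Word.eval_eq_of_equiv (key l)
    simpa [Commute, SemiconjBy, zeta] using this

/-- The automorphism of the braid group that inverts the generators. -/
def invert : Braid →* Braid :=
  PresentedGroup.toGroup (f := fun g => (gen g)⁻¹) (by
    have h1 := gen_t_mul_s2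
    have h2 := gen_s2_mul_s1
    have h3 := gen_t_mul_s1
    have h1' := congrArg (·⁻¹) h1
    have h2' := congrArg (·⁻¹) h2
    have h3' := congrArg (·⁻¹) h3
    simp only [mul_inv_rev, ← mul_assoc] at h1' h2' h3'
    intro r hr
    simp only [braidRelators, Set.mem_insert_iff, Set.mem_singleton_iff] at hr
    rcases hr with rfl | rfl | rfl <;>
      simp only [map_mul, map_inv, FreeGroup.lift_apply_of] <;> rw [mul_inv_eq_one]
    · exact h1'.symm
    · exact h2'
    · exact h3'.symm)

theorem invert_gen (g : Gen) : invert (gen g) = (gen g)⁻¹ := PresentedGroup.toGroup.of _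

theorem invert_letter (x : Letter) : invert x.eval = x.inv.eval := by
  cases x <;> simp [Letter.eval, Letter.inv, invert_gen]

theorem invert_word (w : Word) : invert w.eval = Word.eval (w.map Letter.inv) := by
  induction w with
  | nil => simp
  | cons x w ih => simp [invert_letter, ih]

theorem invert_invert (x : Braid) : invert (invert x) = x := by
  induction x using braid_induction with
  | one => simp
  | step y hy l =>
    have : l.inv.inv = l := by cases l <;> rfl
    simp [hy, invert_letter, this]

theorem invert_zeta : invert zeta = zeta⁻¹ := by
  rw [zeta, invert_word, ← Word.eval_inv]
  exact Word.eval_eq_of_equiv (by decide +kernel)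

theorem invert_mem_parabolic {h : Braid} (hh : h ∈ parabolic) : invert h ∈ parabolic := by
  induction hh using Subgroup.closure_induction with
  | mem x hx =>
    rcases hx with rfl | rfl
    · rw [invert_gen]; exact inv_mem Letter.eval_a_mem
    · rw [invert_gen]; exact inv_mem Letter.eval_b_mem
  | one => simp
  | mul x y _ _ hx hy => rw [map_mul]; exact mul_mem hx hy
  | inv x _ hx => rw [map_inv]; exact inv_mem hx

/-! ### Predicates closed under the Hecke relations -/

/-- A predicate on braids which holds along a line `p t^k q` as soon as it holds at two consecutive
exponents, and along a line `p s^k q` (`s = s₁, s₂`) as soon as it holds at three. The main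
examples are `x ↦ (the image of x lies in M)` for submodules `M` of the Hecke algebra. -/
structure LineClosed (P : Braid → Prop) : Prop where
  line_t : ∀ (p q : Braid) (i : ℤ), P (p * t.eval ^ i * q) → P (p * t.eval ^ (i + 1) * q) →
    ∀ k : ℤ, P (p * t.eval ^ k * q)
  line_a : ∀ (p q : Braid) (i : ℤ), P (p * a.eval ^ i * q) → P (p * a.eval ^ (i + 1) * q) →
    P (p * a.eval ^ (i + 2) * q) → ∀ k : ℤ, P (p * a.eval ^ k * q)
  line_b : ∀ (p q : Braid) (i : ℤ), P (p * b.eval ^ i * q) → P (p * b.eval ^ (i + 1) * q) →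
    P (p * b.eval ^ (i + 2) * q) → ∀ k : ℤ, P (p * b.eval ^ k * q)

namespace LineClosed

variable {P : Braid → Prop} (hP : LineClosed P)
include hP

theorem mul_right (x : Braid) : LineClosed fun y => P (y * x) where
  line_t p q i h0 h1 k := by
    simp only [mul_assoc _ q x] at *; exact hP.line_t p (q * x) i h0 h1 k
  line_a p q i h0 h1 h2 k := by
    simp only [mul_assoc _ q x] at *; exact hP.line_a p (q * x) i h0 h1 h2 k
  line_b p q i h0 h1 h2 k := by
    simp only [mul_assoc _ q x] at *; exact hP.line_b p (q * x) i h0 h1 h2 k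

theorem mul_left (x : Braid) : LineClosed fun y => P (x * y) where
  line_t p q i h0 h1 k := by
    simp only [← mul_assoc] at *; exact hP.line_t (x * p) q i h0 h1 k
  line_a p q i h0 h1 h2 k := by
    simp only [← mul_assoc] at *; exact hP.line_a (x * p) q i h0 h1 h2 k
  line_b p q i h0 h1 h2 k := by
    simp only [← mul_assoc] at *; exact hP.line_b (x * p) q i h0 h1 h2 k

/-- Inverting the generators runs each line backwards, so the known exponents i, i + 1 (and i + 2)
become a block starting at -(i + 1) or -(i + 2). -/
theorem invert : LineClosed fun y => P (invert y) where
  line_t p q i h0 h1 k := by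
    simp only [map_mul, map_zpow, invert_letter, inv] at *
    simp only [show T.eval = t.eval⁻¹ from rfl, inv_zpow'] at *
    exact hP.line_t _ _ (-(i + 1)) h1 (by rwa [show -(i + 1) + 1 = -i by ring]) _
  line_a p q i h0 h1 h2 k := by
    simp only [map_mul, map_zpow, invert_letter, inv] at *
    simp only [show A.eval = a.eval⁻¹ from rfl, inv_zpow'] at *
    exact hP.line_a _ _ (-(i + 2)) h2 (by rwa [show -(i + 2) + 1 = -(i + 1) by ring])
      (by rwa [show -(i + 2) + 2 = -i by ring]) _
  line_b p q i h0 h1 h2 k := by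
    simp only [map_mul, map_zpow, invert_letter, inv] at *
    simp only [show B.eval = b.eval⁻¹ from rfl, inv_zpow'] at *
    exact hP.line_b _ _ (-(i + 2)) h2 (by rwa [show -(i + 2) + 1 = -(i + 1) by ring])
      (by rwa [show -(i + 2) + 2 = -i by ring]) _

/-! Versions for words. -/

theorem word_t (p q : Word) (i k : ℤ) (h0 : P (p ++ Word.pow t i ++ q).eval)
    (h1 : P (p ++ Word.pow t (i + 1) ++ q).eval) : P (p ++ Word.pow t k ++ q).eval := by
  simp only [Word.eval_append, Word.eval_pow] at *
  exact hP.line_t _ _ i h0 h1 k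

theorem word_a (p q : Word) (i k : ℤ) (h0 : P (p ++ Word.pow a i ++ q).eval)
    (h1 : P (p ++ Word.pow a (i + 1) ++ q).eval) (h2 : P (p ++ Word.pow a (i + 2) ++ q).eval) :
    P (p ++ Word.pow a k ++ q).eval := by
  simp only [Word.eval_append, Word.eval_pow] at *
  exact hP.line_a _ _ i h0 h1 h2 k

theorem word_b (p q : Word) (i k : ℤ) (h0 : P (p ++ Word.pow b i ++ q).eval)
    (h1 : P (p ++ Word.pow b (i + 1) ++ q).eval) (h2 : P (p ++ Word.pow b (i + 2) ++ q).eval) :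
    P (p ++ Word.pow b k ++ q).eval := by
  simp only [Word.eval_append, Word.eval_pow] at *
  exact hP.line_b _ _ i h0 h1 h2 k

end LineClosed

theorem Word.transport {P : Braid → Prop} {v w : Word} (h : P v.eval)
    (e : Word.equiv v w = true) : P w.eval :=
  Word.eval_eq_of_equiv e ▸ h

/-! ### The parabolic subgroup -/

/-- Closure under line filling and left multiplication by `s₁`, together with the values at
representatives of the cosets `⟨s₁⟩ \ G₄`. -/
structure ParabolicData (Q : Braid → Prop) : Prop extends LineClosed Q where
  left_a : ∀ x, Q x → Q (a.eval * x)
  one : Q 1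
  b_pow : ∀ j : ℤ, Q (b.eval * a.eval ^ j)
  B_pow : ∀ j : ℤ, Q (B.eval * a.eval ^ j)
  baab : Q (Word.eval [b, a, a, b])

namespace ParabolicData

variable {Q : Braid → Prop} (hQ : ParabolicData Q)
include hQ

theorem left_pow (k : ℤ) {x : Braid} (h : Q x) : Q (a.eval ^ k * x) := by
  have h1 := hQ.left_a x h
  have h2 := hQ.left_a _ h1
  simpa using hQ.line_a 1 x 0 (by simpa using h) (by simpa using h1)
    (by simpa [sq, zpow_ofNat, mul_assoc] using h2) k

theorem left_word (k : ℤ) {v w : Word} (h : Q v.eval)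
    (e : Word.equiv (Word.pow a k ++ v) w = true) : Q w.eval := by
  refine Word.transport ?_ e
  rw [Word.eval_append, Word.eval_pow]
  exact hQ.left_pow k h

theorem word_b_pow (j : ℤ) : Q (Word.eval (b :: Word.pow a j)) := by
  simpa using hQ.b_pow j

theorem word_B_pow (j : ℤ) : Q (Word.eval (B :: Word.pow a j)) := by
  simpa using hQ.B_pow j

/-- The values on `s₂ ^ i s₁ ^ j`. -/
theorem b_pow_pow (i j : ℤ) : Q (b.eval ^ i * a.eval ^ j) := by
  have h := hQ.line_b 1 (a.eval ^ j) (-1) (by simpa [Letter.eval] using hQ.B_pow j)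
    (by simpa using hQ.left_pow j hQ.one) (by simpa using hQ.b_pow j) i
  simpa using h

theorem word_b_pow_pow (i j : ℤ) : Q (Word.eval (Word.pow b i ++ Word.pow a j)) := by
  simpa using hQ.b_pow_pow i j

/-- Together with `mul_right_b` this makes the class of such predicates stable under right
translation by the generators. Here the exponent of s₁ moves by one, and s₂ s₁² s₂ commutes with s₁.
-/
theorem mul_right_a : ParabolicData fun x => Q (x * a.eval) where
  toLineClosed := hQ.toLineClosed.mul_right _
  left_a x h := by rw [mul_assoc]; exact hQ.left_a _ h
  one := by simpa using hQ.left_a 1 hQ.one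
  b_pow j := by rw [mul_assoc, ← zpow_add_one]; exact hQ.b_pow _
  B_pow j := by rw [mul_assoc, ← zpow_add_one]; exact hQ.B_pow _
  baab := by
    have : Q (Word.eval [b, a, a, b, a]) := hQ.left_word 1 hQ.baab (by decide +kernel)
    simpa [mul_assoc] using this

theorem word_b_pow_b (j : ℤ) : Q (Word.eval ([b] ++ Word.pow a j ++ [b])) :=
  hQ.toLineClosed.word_a [b] [b] 0 j (hQ.word_b_pow_pow 2 0)
    (hQ.left_word 1 (hQ.word_b_pow 1) (by decide +kernel)) hQ.baab

/-- Each product of a representative with s₂ lies on a line with three known points. The braid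
relation shows them to be powers of s₁ times known elements. -/
theorem mul_right_b : ParabolicData fun x => Q (x * b.eval) where
  toLineClosed := hQ.toLineClosed.mul_right _
  left_a x h := by rw [mul_assoc]; exact hQ.left_a _ h
  one := by simpa using hQ.b_pow 0
  b_pow j := by simpa [mul_assoc] using hQ.word_b_pow_b j
  B_pow j := by
    have := hQ.toLineClosed.word_a [B] [b] (-1) j
      (hQ.left_word 1 (hQ.word_B_pow (-1)) (by decide +kernel))
      (hQ.left_word 0 (v := []) hQ.one (by decide +kernel))
      (hQ.left_word 1 (hQ.word_b_pow (-1)) (by decide +kernel))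
    simpa [mul_assoc] using this
  baab := by
    have := hQ.toLineClosed.word_b [b, a, a] [] (-1) 2
      (hQ.left_word (-1) (hQ.word_b_pow_pow 2 1) (by decide +kernel))
      (hQ.word_b_pow 2) hQ.baab
    have h := Word.transport (w := [b, a, a, b, b]) this (by decide +kernel)
    simpa [mul_assoc] using h

theorem mul_right_iterate {x : Braid} (hx : ∀ {Q : Braid → Prop}, ParabolicData Q → Q x) :
    Q x ∧ Q (x * a.eval) ∧ Q (x * a.eval * a.eval) ∧ Q (x * b.eval) ∧ Q (x * b.eval * b.eval) :=
  ⟨hx hQ, hx hQ.mul_right_a, hx hQ.mul_right_a.mul_right_a, hx hQ.mul_right_b,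
    hx hQ.mul_right_b.mul_right_b⟩

end ParabolicData

/-- The induction keeps `Q` universally quantified, so the hypothesis for x can be applied to right
translates of `Q`. An inverse generator is the exponent -1 on a line known at 0, 1, 2. -/
theorem ParabolicData.mem {h : Braid} (hh : h ∈ parabolic) :
    ∀ {Q : Braid → Prop}, ParabolicData Q → Q h := by
  induction hh using Subgroup.closure_induction_right with
  | one => exact fun hQ => hQ.one
  | mul_right x _ g hg ih =>
    intro Q hQ
    rcases hg with rfl | rfl
    · exact ih hQ.mul_right_a
    · exact ih hQ.mul_right_b
  | mul_inv_cancel x _ g hg ih =>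
    intro Q hQ
    obtain ⟨h0, ha, haa, hb, hbb⟩ := hQ.mul_right_iterate @ih
    rcases hg with rfl | rfl
    · have := hQ.line_a x 1 0 (by simpa using h0) (by simpa using ha)
        (by simpa [sq, zpow_ofNat, mul_assoc] using haa) (-1)
      simpa [Letter.eval] using this
    · have := hQ.line_b x 1 0 (by simpa using h0) (by simpa using hb)
        (by simpa [sq, zpow_ofNat, mul_assoc] using hbb) (-1)
      simpa [Letter.eval] using this

/-- It suffices to know the values on the eight coset representatives. -/
theorem ParabolicData.of_representatives {Q : Braid → Prop} (hQ : LineClosed Q)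
    (left_a : ∀ x, Q x → Q (a.eval * x)) (one : Q 1)
    (hb : ∀ j ∈ ({-1, 0, 1} : Set ℤ), Q (b.eval * a.eval ^ j))
    (hB : ∀ j ∈ ({-1, 0, 1} : Set ℤ), Q (B.eval * a.eval ^ j))
    (baab : Q (Word.eval [b, a, a, b])) : ParabolicData Q where
  toLineClosed := hQ
  left_a := left_a
  one := one
  b_pow j := by
    simpa using hQ.line_a b.eval 1 (-1) (by simpa using hb (-1) (by simp))
      (by simpa using hb 0 (by simp)) (by simpa using hb 1 (by simp)) j
  B_pow j := by
    simpa using hQ.line_a B.eval 1 (-1) (by simpa using hB (-1) (by simp))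
      (by simpa using hB 0 (by simp)) (by simpa using hB 1 (by simp)) j
  baab := baab

/-! ### Saturated predicates -/

/-- A line closed predicate which is stable under multiplication by the parabolic subgroup on
both sides. -/
structure Saturated (P : Braid → Prop) : Prop extends LineClosed P where
  left : ∀ h ∈ parabolic, ∀ x, P x → P (h * x)
  right : ∀ h ∈ parabolic, ∀ x, P x → P (x * h)

namespace Saturated

variable {P : Braid → Prop} (hP : Saturated P)
include hP

theorem invert : Saturated fun x => P (invert x) where
  toLineClosed := hP.toLineClosed.invert
  left h hh x hx := by rw [map_mul]; exact hP.left _ (invert_mem_parabolic hh) _ hx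
  right h hh x hx := by rw [map_mul]; exact hP.right _ (invert_mem_parabolic hh) _ hx

theorem shift (k : ℤ) : Saturated fun x => P (zeta ^ k * x) where
  toLineClosed := hP.toLineClosed.mul_left _
  left h hh x hx := by
    rw [← mul_assoc, ((zeta_comm h).zpow_left k).eq, mul_assoc]; exact hP.left h hh _ hx
  right h hh x hx := by rw [← mul_assoc]; exact hP.right h hh _ hx

/-- This is the basic move of the derivations below: pass from `v` to another word for the same
double coset of H. -/
theorem conv (l r : Word) {v w : Word} (h : P v.eval)
    (hlr : (l ++ r).all inParabolic = true) (e : Word.equiv (l ++ v ++ r) w = true) :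
    P w.eval := by
  rw [List.all_append, Bool.and_eq_true] at hlr
  refine Word.transport ?_ e
  rw [Word.eval_append, Word.eval_append]
  exact hP.right _ (Word.eval_mem_parabolic hlr.2) _
    (hP.left _ (Word.eval_mem_parabolic hlr.1) _ h)

end Saturated

/-! ### Levels -/

/-- Braids of the form `h₀ t^i₁ h₁ ⋯ t^iₙ hₙ` with all `hᵢ` in the parabolic subgroup. -/
def Level : ℕ → Braid → Prop
  | 0, x => x ∈ parabolic
  | n + 1, x => ∃ h ∈ parabolic, ∃ i : ℤ, ∃ y, Level n y ∧ x = h * t.eval ^ i * y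

theorem Level.succ {n : ℕ} {x : Braid} (h : Level n x) : Level (n + 1) x :=
  ⟨1, one_mem _, 0, x, h, by simp⟩

theorem Level.mul_left {n : ℕ} {h x : Braid} (hh : h ∈ parabolic) (hx : Level n x) :
    Level n (h * x) := by
  cases n with
  | zero => exact mul_mem hh hx
  | succ n =>
    obtain ⟨g, hg, i, y, hy, rfl⟩ := hx
    exact ⟨h * g, mul_mem hh hg, i, y, hy, by simp only [mul_assoc]⟩

theorem Level.invert {n : ℕ} {x : Braid} (hx : Level n x) : Level n (invert x) := by
  induction n generalizing x with
  | zero => exact invert_mem_parabolic hx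
  | succ n ih =>
    obtain ⟨h, hh, i, y, hy, rfl⟩ := hx
    refine ⟨G26.invert h, invert_mem_parabolic hh, -i, G26.invert y, ih hy, ?_⟩
    simp [Letter.eval, invert_gen]

/-- The number of maximal runs of `t ^ ±1` in a word. -/
def Word.level : Word → ℕ
  | [] => 0
  | [x] => if x.inParabolic then 0 else 1
  | x :: y :: w =>
    if x.inParabolic then level (y :: w)
    else if y.inParabolic then level (y :: w) + 1 else level (y :: w)

theorem Letter.eval_eq_t_zpow {x : Letter} (h : ¬ x.inParabolic = true) :
    ∃ i : ℤ, x.eval = t.eval ^ i := by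
  cases x <;> simp [inParabolic] at h
  · exact ⟨1, by simp⟩
  · exact ⟨-1, by simp [Letter.eval]⟩

/-- The second conjunct strengthens the induction: a leading power of t is exposed, so that a
further t^±1 in front merges with it instead of opening a new run. -/
theorem Word.level_eval (w : Word) : Level w.level w.eval ∧
    ∀ x v, w = x :: v → ¬ x.inParabolic = true →
      ∃ n, ∃ i : ℤ, ∃ y, w.level = n + 1 ∧ Level n y ∧ w.eval = t.eval ^ i * y := by
  induction w with
  | nil => exact ⟨one_mem parabolic, by simp⟩
  | cons x w ih =>
    obtain ⟨ih1, ih2⟩ := ih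
    by_cases hx : x.inParabolic = true
    · refine ⟨?_, fun y v h hy => ?_⟩
      · have : Word.level (x :: w) = Word.level w := by
          cases w <;> simp [Word.level, hx]
        rw [this, eval_cons]
        exact ih1.mul_left (Letter.eval_mem_parabolic hx)
      · simp only [List.cons.injEq] at h
        exact absurd (h.1 ▸ hx) hy
    · suffices H : ∃ n, ∃ i : ℤ, ∃ y, Word.level (x :: w) = n + 1 ∧ Level n y ∧
          Word.eval (x :: w) = t.eval ^ i * y by
        refine ⟨?_, fun _ _ _ _ => H⟩
        obtain ⟨n, i, y, h1, h2, h3⟩ := H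
        rw [h1, h3]
        exact ⟨1, one_mem _, i, y, h2, by simp⟩
      obtain ⟨i, hi⟩ := Letter.eval_eq_t_zpow hx
      cases w with
      | nil => exact ⟨0, i, 1, by simp [Word.level, hx], one_mem parabolic, by simp [hi]⟩
      | cons y v =>
        by_cases hy : y.inParabolic = true
        · exact ⟨_, i, _, by simp [Word.level, hx, hy], ih1, by rw [eval_cons, hi]⟩
        · obtain ⟨n, j, u, h1, h2, h3⟩ := ih2 y v rfl hy
          exact ⟨n, i + j, u, by simp [Word.level, hx, hy, h1], h2, by
            rw [eval_cons, hi, h3, zpow_add, mul_assoc]⟩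

/-- `P` holds on all elements of level `n`, multiplied by the `k`-th power of the centre. -/
def Holds (P : Braid → Prop) (n : ℕ) (k : ℤ) : Prop := ∀ x, Level n x → P (zeta ^ k * x)

theorem Holds.word {P : Braid → Prop} {n : ℕ} {k : ℤ} (h : Holds P n k) (w : Word)
    (hw : w.level = n) : P (Word.centerPow k ++ w).eval := by
  rw [Word.eval_append, Word.eval_centerPow]
  exact h _ (hw ▸ w.level_eval.1)

theorem holds_shift {P : Braid → Prop} {n : ℕ} {k l : ℤ} :
    Holds (fun x => P (zeta ^ k * x)) n l ↔ Holds P n (k + l) := by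
  simp only [Holds, zpow_add, mul_assoc]

theorem holds_invert {P : Braid → Prop} {n : ℕ} {k : ℤ} :
    Holds (fun x => P (invert x)) n k ↔ Holds P n (-k) := by
  constructor
  · intro h x hx
    have := h _ hx.invert
    beta_reduce at this
    rwa [map_mul, map_zpow, invert_zeta, invert_invert, inv_zpow'] at this
  · intro h x hx
    rw [map_mul, map_zpow, invert_zeta, inv_zpow']
    exact h _ hx.invert

namespace Saturated

variable {P : Braid → Prop} (hP : Saturated P)
include hP

theorem holds_one {k : ℤ} (h0 : P (zeta ^ k)) (h1 : P (zeta ^ k * t.eval)) : Holds P 1 k := by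
  rintro x ⟨h, hh, i, y, hy, rfl⟩
  have := hP.line_t (zeta ^ k) 1 0 (by simpa using h0) (by simpa using h1) i
  rw [mul_one] at this
  have := (hP.shift k).left h hh _ ((hP.shift k).right y hy _ this)
  simpa only [mul_assoc] using this

/-- A description of all elements of level two by three of them. -/
theorem holds_two (h1 : Holds P 1 0) (hb : P (Word.eval [t, b, t])) (hB : P (Word.eval [t, B, t]))
    (hbaab : P (Word.eval [t, b, a, a, b, t])) : Holds P 2 0 := by
  have hat : t.eval * a.eval = a.eval * t.eval := gen_t_mul_s1
  have hat' (j : ℤ) : t.eval * a.eval ^ j = a.eval ^ j * t.eval :=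
    (Commute.zpow_right hat j).eq
  -- Since t commutes with s₁, powers of s₁ pass through either outer t. Only the double cosets of
  -- ⟨s₁⟩ in G₄ matter, represented by 1, s₂, s₂⁻¹ and s₂ s₁² s₂.
  have main : ParabolicData fun h => P (t.eval * h * t.eval) := by
    refine ⟨(hP.toLineClosed.mul_right t.eval).mul_left t.eval, ?_, ?_, ?_, ?_, ?_⟩
    · intro x hx
      have : t.eval * (a.eval * x) * t.eval = a.eval * (t.eval * x * t.eval) := by
        simp only [← mul_assoc, hat]
      rw [this]
      exact hP.left _ Letter.eval_a_mem _ hx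
    · simpa using h1.word [t, t] rfl
    · intro j
      have : t.eval * (b.eval * a.eval ^ j) * t.eval = t.eval * b.eval * t.eval * a.eval ^ j := by
        simp only [mul_assoc, hat']
      rw [this]
      exact hP.right _ (zpow_mem Letter.eval_a_mem j) _ (by simpa [mul_assoc] using hb)
    · intro j
      have : t.eval * (B.eval * a.eval ^ j) * t.eval = t.eval * B.eval * t.eval * a.eval ^ j := by
        simp only [mul_assoc, hat']
      rw [this]
      exact hP.right _ (zpow_mem Letter.eval_a_mem j) _ (by simpa [mul_assoc] using hB)
    · simpa [mul_assoc] using hbaab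
  rintro x ⟨h, hh, i, y, ⟨g, hg, j, u, hu, rfl⟩, rfl⟩
  rw [zpow_zero, one_mul]
  -- The two exponents of t are filled one after the other: the left one with right exponent 0 or 1
  -- fixed, then the right one.
  have e0 (i : ℤ) : P (t.eval ^ i * g) := by
    have := h1 (t.eval ^ i * g) ⟨1, one_mem _, i, g, hg, by simp⟩
    simpa using this
  have e1 (i : ℤ) : P (t.eval ^ i * g * t.eval) := by
    have := hP.line_t 1 (g * t.eval) 0
      (by simpa using h1 (g * t.eval) ⟨g, hg, 1, 1, one_mem parabolic, by simp⟩)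
      (by simpa [mul_assoc] using main.mem hg) i
    simpa [mul_assoc] using this
  have e2 := hP.line_t (t.eval ^ i * g) 1 0 (by simpa using e0 i) (by simpa using e1 i) j
  have e3 := hP.left h hh _ (hP.right u hu _ e2)
  simpa [mul_assoc] using e3

end Saturated

/-! ### Derivations in a saturated predicate -/

open Word (centerPow)

theorem Level.mono {m n : ℕ} (h : m ≤ n) {x : Braid} (hx : Level m x) : Level n x := by
  induction h with
  | refl => exact hx
  | step _ ih => exact ih.succ

theorem Holds.of_equiv {P : Braid → Prop} {n : ℕ} {k : ℤ} (h : Holds P n k) (v : Word) {w : Word}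
    (hv : (v.level ≤ n) ∧ Word.equiv (centerPow k ++ v) w = true) : P w.eval := by
  refine Word.transport ?_ hv.2
  rw [Word.eval_append, Word.eval_centerPow]
  exact h _ (v.level_eval.1.mono hv.1)

namespace Saturated

variable {P : Braid → Prop} (hP : Saturated P)
include hP

/-- As t commutes with s₁, t s₂ s₁ t s₂ t = ζ (s₁ s₂ s₁)⁻¹. One more t in front still leaves a
single run, so the line also gives the value with the first t deleted. -/
theorem tbt_of_holds (h1 : Holds P 1 1) : P (Word.eval [t, b, t]) := by
  have h := hP.word_t [] [b, a, t, b, t] 1 0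
    (h1.of_equiv [B, A, B] (by decide +kernel)) (h1.of_equiv [A, t, B, A] (by decide +kernel))
  exact hP.conv [A, B] [] h rfl (by decide +kernel)

theorem tBt_of_holds (h0 : Holds P 1 0) (h1 : Holds P 1 (-1)) : P (Word.eval [t, B, t]) := by
  have h : P (G26.invert (Word.eval [t, b, t])) :=
    hP.invert.tbt_of_holds (holds_invert.mpr h1)
  rw [invert_word] at h
  have h2 := hP.word_t [] [B, T] (-1) 1
    (Word.transport h (by decide +kernel)) (h0.of_equiv [B, T] (by decide +kernel))
  exact hP.word_t [t, B] [] (-1) 1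
    (Word.transport h2 (by decide +kernel)) (h0.of_equiv [t, B] (by decide +kernel))

/-- Most lines vary one letter t inside a power of t s₂ s₁: at exponents 1 and 2 the word collapses
to a power of ζ times a single run, and the value at exponent 0 is gained. -/
theorem tbaabt_of_holds (h : ∀ k : ℤ, 1 ≤ k → k ≤ 3 → Holds P 1 k) :
    P (Word.eval [t, b, a, a, b, t]) := by
  have F (k : ℤ) (v : Word) {w : Word} (hv : (1 ≤ k ∧ k ≤ 3 ∧ v.level ≤ 1) ∧
      Word.equiv (centerPow k ++ v) w = true) : P w.eval :=
    (h k hv.1.1 hv.1.2.1).of_equiv v ⟨hv.1.2.2, hv.2⟩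
  have h_tbabatbat := hP.word_t [t, b, a] [b, a, t, b, a, t] 1 0
    (F 1 [t] (by decide +kernel))
    (F 2 [B, B, A, B, T, B, A] (by decide +kernel))
  have h_tbabatbatbatbatbat := hP.word_t [t, b, a] [b, a, t, b, a, t, b, a, t, b, a, t, b, a, t] 1 0
    (F 2 [t] (by decide +kernel))
    (F 3 [B, B, A, B, T, B, A] (by decide +kernel))
  have h_tbabatbatbatbatbaT := hP.word_t [t, b, a] [b, a, t, b, a, t, b, a, t, b, a, t, b, a, T] 1 0
    (F 2 [T] (by decide +kernel))
    (hP.conv [B] [b] h_tbabatbatbatbatbat rfl (by decide +kernel))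
  have h_z1_tbtbAbT := hP.word_a (centerPow 1 ++ [t, b, t, b]) [b, T] 0 (-1)
    (F 1 [b, b, t, b] (by decide +kernel))
    (F 2 [A, B, T, T] (by decide +kernel))
    (hP.conv [b, A] [A] h_tbabatbatbatbatbaT rfl (by decide +kernel))
  have h_tbaTbatbatbatBT := hP.word_t [t, b, a] [b, a, t, b, a, t, b, a, t, B, T] 0 (-1)
    (hP.conv [A] [b, a] h_tbabatbat rfl (by decide +kernel))
    (hP.conv [B, B] [a] h_z1_tbtbAbT rfl (by decide +kernel))
  exact hP.conv [A] [A, B] h_tbaTbatbatbatBT rfl (by decide +kernel)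

theorem holds_two_of_le (h : ∀ k : ℤ, -1 ≤ k → k ≤ 3 → Holds P 1 k) : Holds P 2 0 :=
  hP.holds_two (h 0 (by norm_num) (by norm_num)) (hP.tbt_of_holds (h 1 (by norm_num) (by norm_num)))
    (hP.tBt_of_holds (h 0 (by norm_num) (by norm_num)) (h (-1) (by norm_num) (by norm_num)))
    (hP.tbaabt_of_holds fun k h1 h3 => h k (by linarith) h3)

theorem holds_two_of_ge (h : ∀ k : ℤ, -3 ≤ k → k ≤ 1 → Holds P 1 k) : Holds P 2 0 := by
  have := hP.invert.holds_two_of_le fun k h1 h3 =>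
    holds_invert.mpr (h (-k) (by linarith) (by linarith))
  simpa using holds_invert.mp this

/-- The values on six consecutive multiples by powers of the centre determine the preceding one. -/
theorem holds_pred (h1 : ∀ k : ℤ, -2 ≤ k → k ≤ 3 → Holds P 1 k)
    (h2 : ∀ k : ℤ, -1 ≤ k → k ≤ 2 → Holds P 2 k) : Holds P 1 (-3) := by
  -- `F` supplies the known points: one run for -2 ≤ k ≤ 3, two runs for -1 ≤ k ≤ 2. The facts below
  -- are named after their words, with z1, zm1, … for ζ, ζ⁻¹, … and capitals for inverses; each
  -- fills one line. The targets are ζ⁻² t⁻¹ s₂⁻¹ t⁻¹ and ζ⁻² t s₂⁻¹ s₁⁻¹ t⁻¹ s₂⁻¹ t⁻¹, which lie in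
  -- H ζ⁻³ t H and H ζ⁻³ t² H.
  have F (k : ℤ) (v : Word) {w : Word} (hv : ((-2 ≤ k ∧ k ≤ 3 ∧ v.level ≤ 1) ∨
      (-1 ≤ k ∧ k ≤ 2 ∧ v.level ≤ 2)) ∧ Word.equiv (centerPow k ++ v) w = true) : P w.eval := by
    rcases hv.1 with h | h
    · exact (h1 k h.1 h.2.1).of_equiv v ⟨h.2.2, hv.2⟩
    · exact (h2 k h.1 h.2.1).of_equiv v ⟨h.2.2, hv.2⟩
  have h_zm1_TbAtBT := hP.word_t (centerPow (-1)) [b, A, t, B, T] 0 (-1)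
    (F (-1) [b, A, t, B, T] (by decide +kernel))
    (F 0 [A, B, A, T, B, A, A, B, T] (by decide +kernel))
  have h_zm1_TbATBT := hP.word_t (centerPow (-1)) [b, A, T, B, T] 0 (-1)
    (F (-1) [b, A, T, B, T] (by decide +kernel))
    (hP.conv [B] [a] h_zm1_TbAtBT rfl (by decide +kernel))
  have h_zm1_TBBATBT := hP.word_b (centerPow (-1) ++ [T]) [A, T, B, T] (-1) (-2)
    (F (-2) [a, b, a] (by decide +kernel))
    (F (-1) [A, T, T, B, T] (by decide +kernel))
    (hP.conv [] [] h_zm1_TbATBT rfl (by decide +kernel))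
  have h_zm2_TBT := hP.word_t (centerPow (-2)) [B, T] 0 (-1)
    (F (-2) [B, T] (by decide +kernel))
    (hP.conv [B] [B, A] h_zm1_TBBATBT rfl (by decide +kernel))
  have h_zm2_TbAtBT := hP.word_t (centerPow (-2)) [b, A, t, B, T] 0 (-1)
    (hP.conv [b, A, B] [B, A] h_zm1_TBBATBT rfl (by decide +kernel))
    (F (-1) [A, B, A, T, B, A, A, B, T] (by decide +kernel))
  have h_zm2_ttbAtBT := hP.word_t (centerPow (-2)) [b, A, t, B, T] 0 2
    (hP.conv [b, A, B] [B, A] h_zm1_TBBATBT rfl (by decide +kernel))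
    (F (-1) [A, B, A, T, B, A, A, B, T] (by decide +kernel))
  have h_zm1_TBBAttbt := hP.word_t (centerPow (-1) ++ [T, B, B, A]) [b, t] 0 2
    (F (-1) [T, B, B, A, b, t] (by decide +kernel))
    (F 0 [T, B, B, A, A, B, T, A, B, A] (by decide +kernel))
  have h_TBBTBAABT := hP.word_t [] [B, B, T, B, A, A, B, T] 0 (-1)
    (F 0 [B, B, T, B, A, A, B, T] (by decide +kernel))
    (hP.conv [B] [a, b, a] h_zm1_TBBAttbt rfl (by decide +kernel))
  have h_TBaBaTBt := hP.word_t [T, B, a, B, a, T, B] [] (-1) 1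
    (F (-1) [a, T, b, b, A, b, t, b, a] (by decide +kernel))
    (F 0 [T, B, a, B, a, T, B] (by decide +kernel))
  have h_tbbtBAABT := hP.word_t [t, b, b] [B, A, A, B, T] (-1) 1
    (hP.conv [B, A] [b] h_TBaBaTBt rfl (by decide +kernel))
    (F 0 [t, b, A, A, B, T] (by decide +kernel))
  have h_tBtBAABT := hP.word_b [t] [t, B, A, A, B, T] 0 (-1)
    (F 0 [t, t, B, A, A, B, T] (by decide +kernel))
    (F 1 [B, A, B, T, B, B, A, A, B, T, A] (by decide +kernel))
    (hP.conv [] [] h_tbbtBAABT rfl (by decide +kernel))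
  have h_TbAtbbt := hP.word_t [] [b, A, t, b, b, t] 0 (-1)
    (F 0 [b, A, t, b, b, t] (by decide +kernel))
    (F 1 [A, B, T, B, a, B, t, A] (by decide +kernel))
  have h_TbAtbAbt := hP.word_t [] [b, A, t, b, A, b, t] 0 (-1)
    (F 0 [b, A, t, b, A, b, t] (by decide +kernel))
    (F 1 [A, B, T, B, a, B, B, t, A] (by decide +kernel))
  have h_Tbtbaabt := hP.word_t [] [b, t, b, a, a, b, t] 0 (-1)
    (F 0 [b, t, b, a, a, b, t] (by decide +kernel))
    (F 1 [b, A, B, T, b, t, A] (by decide +kernel))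
  have h_TbatbatbatbAtbAbt := hP.word_t [] [b, a, t, b, a, t, b, a, t, b, A, t, b, A, b, t] 0 (-1)
    (F 1 [b, A, t, b, A, b, t] (by decide +kernel))
    (F 2 [A, B, T, B, a, B, B, t, A] (by decide +kernel))
  have h_z1_Tbaabtbtt := hP.word_t (centerPow 1 ++ [T, b, a, a, b, t, b]) [] 0 2
    (F 1 [T, b, a, a, b, t, b] (by decide +kernel))
    (F 2 [A, T, b, T, a, B, A] (by decide +kernel))
  have h_tbatbabatbbatbt := hP.word_t [t, b, a, t, b, a] [b, a, t, b, b, a, t, b, t] 1 0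
    (F 2 [B, T, b, t, A, B] (by decide +kernel))
    (F 3 [A, B, B, B, A, B, T, T, B, A] (by decide +kernel))
  have h_z2_tbTBaBBT := hP.word_b (centerPow 2 ++ [t, b, T, B, a]) [T] (-1) (-2)
    (hP.conv [B] [a, b] h_z1_Tbaabtbtt rfl (by decide +kernel))
    (F 1 [a, b, t, b, t, a, b, b, a] (by decide +kernel))
    (hP.conv [a] [a, b, a] h_tbatbabatbbatbt rfl (by decide +kernel))
  have h_z2_TbAAtBBT := hP.word_a (centerPow 2 ++ [T, b]) [t, B, B, T] (-1) (-2)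
    (F 1 [b, t, b, A, b, t, a, b] (by decide +kernel))
    (F 2 [T, T, B, B, t, b] (by decide +kernel))
    (hP.conv [b] [] h_z2_tbTBaBBT rfl (by decide +kernel))
  have h_tbabatbatbaabAtBBT := hP.word_t [t, b, a] [b, a, t, b, a, t, b, a, a, b, A, t, B, B, T] 1 0
    (hP.conv [A, B] [a, b] h_TbatbatbatbAtbAbt rfl (by decide +kernel))
    (hP.conv [A, B] [] h_z2_TbAAtBBT rfl (by decide +kernel))
  have h_tbaabtbAbT := hP.word_t [t, b, a, a, b, t, b, A, b] [] 0 (-1)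
    (F 0 [t, b, a, a, b, t, b, A, b] (by decide +kernel))
    (hP.conv [] [B, A] h_tbabatbatbaabAtBBT rfl (by decide +kernel))
  have h_tbaabtBBAbT := hP.word_b [t, b, a, a, b, t] [A, b, T] (-1) (-2)
    (hP.conv [a, B] [a, b, A] h_TbAtbbt rfl (by decide +kernel))
    (hP.conv [A, B] [b] h_Tbtbaabt rfl (by decide +kernel))
    (hP.conv [] [] h_tbaabtbAbT rfl (by decide +kernel))
  have h_tbaabtBAABT := hP.word_a [t, b, a, a, b, t, B] [B, T] (-1) (-2)
    (hP.conv [A, B] [a, b, A] h_TbAtbbt rfl (by decide +kernel))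
    (hP.conv [B] [a, b] h_TbAtbAbt rfl (by decide +kernel))
    (hP.conv [] [a] h_tbaabtBBAbT rfl (by decide +kernel))
  have h_tBBaabtBAABT := hP.word_b [t] [a, a, b, t, B, A, A, B, T] (-1) (-2)
    (hP.conv [a] [A] h_tbbtBAABT rfl (by decide +kernel))
    (F 1 [a, B, A, T, B, B, A, A, B, T, A] (by decide +kernel))
    (hP.conv [] [] h_tbaabtBAABT rfl (by decide +kernel))
  have h_tBBAbtBAABT := hP.word_b [t] [A, b, t, B, A, A, B, T] (-1) (-2)
    (hP.conv [a] [A] h_tBtBAABT rfl (by decide +kernel))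
    (F 1 [A, B, A, B, T, B, B, A, A, B, T, A] (by decide +kernel))
    (hP.conv [A] [a] h_tBBaabtBAABT rfl (by decide +kernel))
  have h_TBaBtBAABT := hP.word_t [] [B, a, B, t, B, A, A, B, T] 0 (-1)
    (F 0 [B, a, B, t, B, A, A, B, T] (by decide +kernel))
    (hP.conv [] [a] h_tBBAbtBAABT rfl (by decide +kernel))
  have h_TBaBTBAABT := hP.word_t [T, B, a, B] [B, A, A, B, T] 0 (-1)
    (F 0 [T, B, a, B, B, A, A, B, T] (by decide +kernel))
    (hP.conv [] [] h_TBaBtBAABT rfl (by decide +kernel))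
  have h_TBAABTBAABT := hP.word_a [T, B] [B, T, B, A, A, B, T] (-1) (-2)
    (F (-1) [b, A, B, T, B, t, b] (by decide +kernel))
    (hP.conv [] [] h_TBBTBAABT rfl (by decide +kernel))
    (hP.conv [] [] h_TBaBTBAABT rfl (by decide +kernel))
  -- Here ζ⁻² is spelled (s₁⁻¹ s₂⁻¹ t⁻¹)⁶, and its second t⁻¹ is the letter that varies.
  have h_zm2_tbbAtBT :=
    hP.word_t [A, B, T, A, B] [A, B, T, A, B, T, A, B, T, A, B, T, t, b, b, A, t, B, T] 0 (-1)
    (hP.conv [] [a] h_zm2_ttbAtBT rfl (by decide +kernel))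
    (hP.conv [B, A, B, A] [] h_TBAABTBAABT rfl (by decide +kernel))
  have h_zm2_TbbAtBT := hP.word_t (centerPow (-2)) [b, b, A, t, B, T] 0 (-1)
    (hP.conv [b, b, A, B] [B, A] h_zm1_TBBATBT rfl (by decide +kernel))
    (hP.conv [] [] h_zm2_tbbAtBT rfl (by decide +kernel))
  have h_zm2_tBBbATBT := hP.word_b (centerPow (-2) ++ [t]) [b, A, T, B, T] (-1) (-2)
    (F (-2) [A, B, T] (by decide +kernel))
    (hP.conv [B] [a] h_zm2_TbAtBT rfl (by decide +kernel))
    (hP.conv [B] [a] h_zm2_TbbAtBT rfl (by decide +kernel))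
  -- Exponents 1 and 2 of t are known, hence also 0.
  have h_zm3 := hP.word_t (centerPow (-3)) [] 1 0
    (hP.conv [A, B, A] [A, B] h_zm2_TBT rfl (by decide +kernel))
    (hP.conv [A] [A, B] h_zm2_tBBbATBT rfl (by decide +kernel))
  have h_zm3_t : P (Word.eval (centerPow (-3) ++ [t])) :=
    hP.conv [A, B, A] [A, B] h_zm2_TBT rfl (by decide +kernel)
  exact hP.holds_one (by simpa using h_zm3) (by simpa using h_zm3_t)

end Saturated

/-! ### Every braid is reached -/

namespace Saturated

theorem holds_sub_one {P : Braid → Prop} (hP : Saturated P) (l : ℤ)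
    (h : ∀ k : ℤ, l ≤ k → k ≤ l + 5 → Holds P 1 k) : Holds P 1 (l - 1) := by
  -- The shift moves the window l, …, l + 5 to -2, …, 3.
  have hS := hP.shift (l + 2)
  have h1 (k : ℤ) (h1 : -2 ≤ k) (h2 : k ≤ 3) :
      Holds (fun x => P (zeta ^ (l + 2) * x)) 1 k :=
    holds_shift.mpr (h _ (by linarith) (by linarith))
  have h2 (k : ℤ) (hk1 : -1 ≤ k) (hk2 : k ≤ 2) :
      Holds (fun x => P (zeta ^ (l + 2) * x)) 2 k := by
    rw [← add_zero k]
    refine holds_shift.mp ?_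
    -- Two runs at k need one run either on k - 1, …, k + 3 or on k - 3, …, k + 1. The first range
    -- fits in the window for k = -1, 0, the second for k = 1, 2.
    by_cases hk : k ≤ 0
    · exact (hS.shift k).holds_two_of_le fun j hj1 hj2 =>
        holds_shift.mpr (h1 _ (by linarith) (by linarith))
    · exact (hS.shift k).holds_two_of_ge fun j hj1 hj2 =>
        holds_shift.mpr (h1 _ (by omega) (by omega))
  have := holds_shift.mp (hS.holds_pred h1 h2)
  rwa [show l + 2 + -3 = l - 1 by ring] at this

theorem holds_add_six {P : Braid → Prop} (hP : Saturated P) (l : ℤ)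
    (h : ∀ k : ℤ, l ≤ k → k ≤ l + 5 → Holds P 1 k) : Holds P 1 (l + 6) := by
  have := hP.invert.holds_sub_one (-(l + 5)) fun k h1 h2 =>
    holds_invert.mpr (h (-k) (by linarith) (by linarith))
  have := holds_invert.mp this
  rwa [show -(-(l + 5) - 1) = l + 6 by ring] at this

theorem holds_one_all {P : Braid → Prop} (hP : Saturated P)
    (h : ∀ k : ℤ, -2 ≤ k → k ≤ 3 → Holds P 1 k) (k : ℤ) : Holds P 1 k := by
  have window : ∀ l : ℤ, ∀ k : ℤ, l ≤ k → k ≤ l + 5 → Holds P 1 k := by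
    intro l
    induction l using Int.inductionOn' (b := -2) with
    | zero => exact h
    | succ l _ ih =>
      intro k h1 h2
      rcases eq_or_lt_of_le h2 with h2 | h2
      · rw [h2, show l + 1 + 5 = l + 6 by ring]
        exact hP.holds_add_six l ih
      · exact ih k (by omega) (by omega)
    | pred l _ ih =>
      intro k h1 h2
      rcases eq_or_lt_of_le h1 with h1 | h1
      · rw [← h1]
        exact hP.holds_sub_one l ih
      · exact ih k (by omega) (by omega)
  exact window k k le_rfl (by linarith)

theorem holds_two_all {P : Braid → Prop} (hP : Saturated P)
    (h : ∀ k : ℤ, -2 ≤ k → k ≤ 3 → Holds P 1 k) (k : ℤ) : Holds P 2 k := by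
  rw [← add_zero k]
  exact holds_shift.mp ((hP.shift k).holds_two_of_le fun j _ _ =>
    holds_shift.mpr (hP.holds_one_all h _))

/-- Right translation by `t`, made stable under the parabolic subgroup on the right. -/
theorem mul_right_t {P : Braid → Prop} (hP : Saturated P) :
    Saturated fun x => ∀ h ∈ parabolic, P (x * h * t.eval) where
  line_t p q i h0 h1 k h hh := by
    have := ((hP.toLineClosed.mul_right t.eval).mul_right h).line_t p q i (h0 h hh) (h1 h hh) k
    exact this
  line_a p q i h0 h1 h2 k h hh := by
    have := ((hP.toLineClosed.mul_right t.eval).mul_right h).line_a p q i (h0 h hh) (h1 h hh)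
      (h2 h hh) k
    exact this
  line_b p q i h0 h1 h2 k h hh := by
    have := ((hP.toLineClosed.mul_right t.eval).mul_right h).line_b p q i (h0 h hh) (h1 h hh)
      (h2 h hh) k
    exact this
  left g hg x hx h hh := by
    have := hP.left g hg _ (hx h hh)
    simpa only [mul_assoc] using this
  right g hg x hx h hh := by
    have := hx (g * h) (mul_mem hg hh)
    simpa only [mul_assoc] using this

/-- One run times H t has at most two runs, and these are already covered for every power of ζ. So
the translated predicate meets the hypotheses of `forall_braid`. -/
theorem holds_mul_right_t {P : Braid → Prop} (hP : Saturated P)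
    (h : ∀ k : ℤ, -2 ≤ k → k ≤ 3 → Holds P 1 k) (k : ℤ) :
    Holds (fun x => ∀ h ∈ parabolic, P (x * h * t.eval)) 1 k := by
  rintro x ⟨g, hg, i, u, hu, rfl⟩ h' hh'
  have := hP.holds_two_all h k (g * t.eval ^ i * (u * h' * t.eval))
    ⟨g, hg, i, _, ⟨u * h', mul_mem hu hh', 1, 1, one_mem parabolic, by simp⟩, rfl⟩
  simpa only [mul_assoc] using this

/-- `P` varies in the induction: the hypothesis for y is used for `P` and for its translate by t,
giving exponents 0 and 1 on the line y t^i. -/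
theorem forall_braid (x : Braid) : ∀ {P : Braid → Prop}, Saturated P →
    (∀ k : ℤ, -2 ≤ k → k ≤ 3 → Holds P 1 k) → P x := by
  induction x using braid_induction with
  | one =>
    exact fun _ h => (h 0 (by norm_num) (by norm_num)).of_equiv (w := []) [] (by decide +kernel)
  | step y ih l =>
    intro P hP h
    by_cases hl : l.inParabolic = true
    · exact hP.right _ (Letter.eval_mem_parabolic hl) _ (ih hP h)
    · obtain ⟨i, hi⟩ := Letter.eval_eq_t_zpow hl
      have h0 := ih hP h
      have h1 := ih hP.mul_right_t (fun k _ _ => hP.holds_mul_right_t h k) 1 (one_mem _)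
      have := hP.line_t y 1 0 (by simpa using h0) (by simpa using h1) i
      simpa [hi] using this

end Saturated

/-! ### The generating families -/

/-- Representatives of the cosets `⟨s₁⟩ \ G₄`. -/
def representative : Fin 8 → Word :=
  ![[], [b], [b, a], [b, A], [B], [B, a], [B, A], [b, a, a, b]]

/-- The exponents of the centre. -/
def exponent : Fin 6 → ℤ := ![0, 1, 2, 3, -1, -2]

/-- The words `s₁ ^ i v`, with `v` a coset representative. -/
def parabolicWord (p : Fin 3 × Fin 8) : Word := Word.pow a (p.1 : ℕ) ++ representative p.2

/-- The words `ζ ^ k` and `ζ ^ k t v`, with `v` a coset representative. -/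
def cosetWord (p : Fin 6 × Fin 9) : Word :=
  Word.centerPow (exponent p.1) ++
    (Fin.cases [] (fun j => t :: representative j) p.2 : Word)

theorem parabolicWord_mem (p : Fin 3 × Fin 8) : (parabolicWord p).eval ∈ parabolic := by
  rw [parabolicWord, Word.eval_append, Word.eval_pow]
  refine mul_mem (zpow_mem Letter.eval_a_mem _) (Word.eval_mem_parabolic ?_)
  generalize p.2 = j
  revert j
  decide

theorem exists_exponent {k : ℤ} (h1 : -2 ≤ k) (h2 : k ≤ 3) : ∃ i, exponent i = k := by
  interval_cases k
  exacts [⟨5, rfl⟩, ⟨4, rfl⟩, ⟨0, rfl⟩, ⟨1, rfl⟩, ⟨2, rfl⟩, ⟨3, rfl⟩]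

theorem ParabolicData.of_representative {Q : Braid → Prop} (hQ : LineClosed Q)
    (left_a : ∀ x, Q x → Q (a.eval * x)) (h : ∀ j, Q (representative j).eval) :
    ParabolicData Q := by
  refine .of_representatives hQ left_a (h 0) ?_ ?_ (h 7)
  · rintro j (rfl | rfl | rfl)
    · simpa [representative, Letter.eval] using h 3
    · simpa [representative] using h 1
    · simpa [representative] using h 2
  · rintro j (rfl | rfl | rfl)
    · simpa [representative, Letter.eval] using h 6
    · simpa [representative] using h 4
    · simpa [representative] using h 5

/-- A line closed predicate that is stable under left multiplication by the parabolic subgroup and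
holds on the 54 coset words holds on all braids. -/
theorem LineClosed.forall_braid {P : Braid → Prop} (hP : LineClosed P)
    (left : ∀ h ∈ parabolic, ∀ x, P x → P (h * x)) (hc : ∀ p, P (cosetWord p).eval) (x : Braid) :
    P x := by
  have hat : t.eval * a.eval = a.eval * t.eval := gen_t_mul_s1
  -- Quantifying over right factors in H supplies the missing stability on the right.
  have hS : Saturated fun x => ∀ h ∈ parabolic, P (x * h) :=
    { line_t := fun p q i h0 h1 k h hh =>
        (hP.mul_right h).line_t p q i (h0 h hh) (h1 h hh) k
      line_a := fun p q i h0 h1 h2 k h hh =>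
        (hP.mul_right h).line_a p q i (h0 h hh) (h1 h hh) (h2 h hh) k
      line_b := fun p q i h0 h1 h2 k h hh =>
        (hP.mul_right h).line_b p q i (h0 h hh) (h1 h hh) (h2 h hh) k
      left := fun g hg x hx h hh => by rw [mul_assoc]; exact left g hg _ (hx h hh)
      right := fun g hg x hx h hh => by rw [mul_assoc]; exact hx _ (mul_mem hg hh) }
  have hmem := Saturated.forall_braid x hS fun k h1 h2 => by
    obtain ⟨i, rfl⟩ := exists_exponent h1 h2
    have h0 := hc (i, 0)
    simp only [cosetWord, Fin.cases_zero, List.append_nil, Word.eval_centerPow] at h0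
    refine hS.holds_one (fun h hh => ?_) (fun h hh => ?_)
    · rw [((zeta_comm h).zpow_left _).eq]
      exact left h hh _ h0
    · have hdata : ParabolicData fun h => P (zeta ^ exponent i * t.eval * h) := by
        refine .of_representative (hP.mul_left _) (fun x hx => ?_) fun j => ?_
        · have e : zeta ^ exponent i * t.eval * (a.eval * x) =
              a.eval * (zeta ^ exponent i * t.eval * x) := by
            have hz := ((zeta_comm a.eval).zpow_left (exponent i)).eq
            rw [mul_assoc, ← mul_assoc t.eval, hat, mul_assoc, ← mul_assoc, hz]
            simp only [mul_assoc]
          rw [e]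
          exact left _ Letter.eval_a_mem _ hx
        · have := hc (i, j.succ)
          simpa [cosetWord, mul_assoc] using this
      exact hdata.mem hh
  simpa using hmem 1 (one_mem _)

/-! ### The Hecke algebra -/

theorem zline_two {Q : ℤ → Prop} (up : ∀ k, Q k → Q (k + 1) → Q (k + 2))
    (down : ∀ k, Q (k + 1) → Q (k + 2) → Q k) (i : ℤ) (h0 : Q i) (h1 : Q (i + 1)) (k : ℤ) :
    Q k := by
  suffices H : Q k ∧ Q (k + 1) from H.1
  induction k using Int.inductionOn' (b := i) with
  | zero => exact ⟨h0, h1⟩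
  | succ k _ ih => exact ⟨ih.2, by rw [add_assoc]; exact up k ih.1 ih.2⟩
  | pred k _ ih =>
    have e : k - 1 + 1 = k := by ring
    refine ⟨down _ (by rw [e]; exact ih.1) ?_, by rw [e]; exact ih.1⟩
    rw [show k - 1 + 2 = k + 1 by ring]; exact ih.2

theorem zline_three {Q : ℤ → Prop} (up : ∀ k, Q k → Q (k + 1) → Q (k + 2) → Q (k + 3))
    (down : ∀ k, Q (k + 1) → Q (k + 2) → Q (k + 3) → Q k) (i : ℤ) (h0 : Q i) (h1 : Q (i + 1))
    (h2 : Q (i + 2)) (k : ℤ) : Q k := by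
  suffices H : Q k ∧ Q (k + 1) ∧ Q (k + 2) from H.1
  induction k using Int.inductionOn' (b := i) with
  | zero => exact ⟨h0, h1, h2⟩
  | succ k _ ih =>
    refine ⟨ih.2.1, ?_, ?_⟩
    · rw [add_assoc]; exact ih.2.2
    · rw [add_assoc]; exact up k ih.1 ih.2.1 ih.2.2
  | pred k _ ih =>
    have e1 : k - 1 + 1 = k := by ring
    have e2 : k - 1 + 2 = k + 1 := by ring
    have e3 : k - 1 + 3 = k + 2 := by ring
    refine ⟨down _ ?_ ?_ ?_, ?_, ?_⟩
    · rw [e1]; exact ih.1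
    · rw [e2]; exact ih.2.1
    · rw [e3]; exact ih.2.2
    · rw [e1]; exact ih.1
    · rw [e2]; exact ih.2.1

/-- Going down, the relation gives γ • f j in N, and the unit γ can be cancelled. -/
theorem mem_of_cubic {k M : Type*} [CommRing k] [AddCommGroup M] [Module k M] {α β γ : k}
    (hγ : IsUnit γ) (N : Submodule k M) {f : ℤ → M}
    (rel : ∀ j, f (j + 3) = α • f (j + 2) + β • f (j + 1) + γ • f j) (i : ℤ) (h0 : f i ∈ N)
    (h1 : f (i + 1) ∈ N) (h2 : f (i + 2) ∈ N) (j : ℤ) : f j ∈ N := by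
  refine zline_three (Q := fun j => f j ∈ N) (fun j hj0 hj1 hj2 => ?_) (fun j hj1 hj2 hj3 => ?_)
    i h0 h1 h2 j
  · rw [rel]
    exact add_mem (add_mem (N.smul_mem _ hj2) (N.smul_mem _ hj1)) (N.smul_mem _ hj0)
  · refine (Submodule.smul_mem_iff_of_isUnit N hγ).mp ?_
    rw [← sub_eq_of_eq_add' (rel j)]
    exact sub_mem hj3 (add_mem (N.smul_mem _ hj2) (N.smul_mem _ hj1))

section Relations

variable {k : Type} [CommRing k] {α β γ δ ε : k}

theorem ofBraid_t_sq : ofBraid k α β γ δ ε t.eval ^ 2 =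
    δ • ofBraid k α β γ δ ε t.eval + ε • 1 := by
  have := RingQuot.mkAlgHom_rel k (HeckeRel.t (k := k) (a := α) (b := β) (c := γ) (d := δ) (e := ε))
  simp only [map_pow, map_add, map_smul, map_one] at this
  exact this

theorem ofBraid_a_cube : ofBraid k α β γ δ ε a.eval ^ 3 =
    α • ofBraid k α β γ δ ε a.eval ^ 2 + β • ofBraid k α β γ δ ε a.eval + γ • 1 := by
  have := RingQuot.mkAlgHom_rel k
    (HeckeRel.s1 (k := k) (a := α) (b := β) (c := γ) (d := δ) (e := ε))
  simp only [map_pow, map_add, map_smul, map_one] at this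
  exact this

theorem ofBraid_b_cube : ofBraid k α β γ δ ε b.eval ^ 3 =
    α • ofBraid k α β γ δ ε b.eval ^ 2 + β • ofBraid k α β γ δ ε b.eval + γ • 1 := by
  have := RingQuot.mkAlgHom_rel k
    (HeckeRel.s2 (k := k) (a := α) (b := β) (c := γ) (d := δ) (e := ε))
  simp only [map_pow, map_add, map_smul, map_one] at this
  exact this

/-- Membership of the image in a submodule is a line closed predicate. -/
theorem LineClosed.mem_submodule (hγ : IsUnit γ) (hε : IsUnit ε)
    (M : Submodule k (Hecke k α β γ δ ε)) : LineClosed fun x => ofBraid k α β γ δ ε x ∈ M where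
  line_t p q i h0 h1 := by
    have rel (j : ℤ) : ofBraid k α β γ δ ε (p * t.eval ^ (j + 2) * q) =
        δ • ofBraid k α β γ δ ε (p * t.eval ^ (j + 1) * q) +
          ε • ofBraid k α β γ δ ε (p * t.eval ^ j * q) := by
      have h2 : t.eval ^ (j + 2) = t.eval ^ j * t.eval ^ 2 := by rw [zpow_add]; rfl
      rw [h2, zpow_add_one]
      simp only [map_mul, map_pow, ofBraid_t_sq]
      simp only [mul_add, add_mul, mul_smul_comm, smul_mul_assoc, mul_one]
    refine zline_two (Q := fun j => ofBraid k α β γ δ ε (p * t.eval ^ j * q) ∈ M)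
      (fun j hj0 hj1 => ?_) (fun j hj1 hj2 => ?_) i h0 h1
    · rw [rel]
      exact add_mem (M.smul_mem _ hj1) (M.smul_mem _ hj0)
    · refine (Submodule.smul_mem_iff_of_isUnit M hε).mp ?_
      rw [← sub_eq_of_eq_add' (rel j)]
      exact sub_mem hj2 (M.smul_mem _ hj1)
  line_a p q i h0 h1 h2 := by
    have rel (j : ℤ) : ofBraid k α β γ δ ε (p * a.eval ^ (j + 3) * q) =
        α • ofBraid k α β γ δ ε (p * a.eval ^ (j + 2) * q) +
          β • ofBraid k α β γ δ ε (p * a.eval ^ (j + 1) * q) +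
          γ • ofBraid k α β γ δ ε (p * a.eval ^ j * q) := by
      have h3 : a.eval ^ (j + 3) = a.eval ^ j * a.eval ^ 3 := by rw [zpow_add]; rfl
      have h2 : a.eval ^ (j + 2) = a.eval ^ j * a.eval ^ 2 := by rw [zpow_add]; rfl
      rw [h3, h2, zpow_add_one]
      simp only [map_mul, map_pow, ofBraid_a_cube]
      simp only [mul_add, add_mul, mul_smul_comm, smul_mul_assoc, mul_one]
    exact mem_of_cubic hγ M rel i h0 h1 h2
  line_b p q i h0 h1 h2 := by
    have rel (j : ℤ) : ofBraid k α β γ δ ε (p * b.eval ^ (j + 3) * q) =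
        α • ofBraid k α β γ δ ε (p * b.eval ^ (j + 2) * q) +
          β • ofBraid k α β γ δ ε (p * b.eval ^ (j + 1) * q) +
          γ • ofBraid k α β γ δ ε (p * b.eval ^ j * q) := by
      have h3 : b.eval ^ (j + 3) = b.eval ^ j * b.eval ^ 3 := by rw [zpow_add]; rfl
      have h2 : b.eval ^ (j + 2) = b.eval ^ j * b.eval ^ 2 := by rw [zpow_add]; rfl
      rw [h3, h2, zpow_add_one]
      simp only [map_mul, map_pow, ofBraid_b_cube]
      simp only [mul_add, add_mul, mul_smul_comm, smul_mul_assoc, mul_one]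
    exact mem_of_cubic hγ M rel i h0 h1 h2

/-- The braids span the Hecke algebra. -/
theorem span_range_ofBraid :
    Submodule.span k (Set.range (ofBraid k α β γ δ ε)) = ⊤ := by
  rw [eq_top_iff]
  rintro x -
  obtain ⟨y, rfl⟩ := RingQuot.mkAlgHom_surjective k (HeckeRel k α β γ δ ε) x
  induction y using MonoidAlgebra.induction_on with
  | of g => exact Submodule.subset_span ⟨g, rfl⟩
  | add f g hf hg => rw [map_add]; exact add_mem hf hg
  | smul r f hf => rw [map_smul]; exact Submodule.smul_mem _ r hf

end Relations

/-! ### The generic parameters and the spanning families -/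

theorem isUnit_param_c : IsUnit (param Param.c) :=
  isUnit_of_mul_isUnit_left (y := param Param.e) <| by
    rw [param, param, ← map_mul]
    exact IsLocalization.Away.algebraMap_isUnit _

theorem isUnit_param_e : IsUnit (param Param.e) :=
  isUnit_of_mul_isUnit_right (x := param Param.c) <| by
    rw [param, param, ← map_mul]
    exact IsLocalization.Away.algebraMap_isUnit _

theorem lineClosed_mem (M : Submodule R GenericHecke) : LineClosed fun x => toHecke x ∈ M :=
  .mem_submodule isUnit_param_c isUnit_param_e M

theorem toHecke_mem_A3 {h : Braid} (hh : h ∈ parabolic) : toHecke h ∈ A3 := by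
  have ha : toHecke a.eval ∈ A3 := Algebra.subset_adjoin (Or.inl rfl)
  have hb : toHecke b.eval ∈ A3 := Algebra.subset_adjoin (Or.inr rfl)
  have hL := lineClosed_mem (Subalgebra.toSubmodule A3)
  have mem_mul {x y : Braid} (hx : toHecke x ∈ A3) (hy : toHecke y ∈ A3) :
      toHecke (x * y) ∈ A3 := by rw [map_mul]; exact mul_mem hx hy
  have one : toHecke 1 ∈ A3 := by rw [map_one]; exact one_mem _
  -- Inverses of generators stay in the subalgebra because c is a unit: exponent -1 follows from 0,
  -- 1, 2.
  have hA : toHecke A.eval ∈ A3 := by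
    have := hL.line_a 1 1 0 (by simp) (by simpa using ha)
      (by simpa [sq, zpow_ofNat] using mem_mul ha ha) (-1)
    simpa [Letter.eval] using this
  have hB : toHecke B.eval ∈ A3 := by
    have := hL.line_b 1 1 0 (by simp) (by simpa using hb)
      (by simpa [sq, zpow_ofNat] using mem_mul hb hb) (-1)
    simpa [Letter.eval] using this
  induction hh using Subgroup.closure_induction_right with
  | one => exact one
  | mul_right x _ g hg ih =>
    rcases hg with rfl | rfl
    · exact mem_mul ih ha
    · exact mem_mul ih hb
  | mul_inv_cancel x _ g hg ih =>
    rcases hg with rfl | rfl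
    · exact mem_mul ih hA
    · exact mem_mul ih hB

theorem toHecke_mem_span_parabolicWord {h : Braid} (hh : h ∈ parabolic) :
    toHecke h ∈ Submodule.span R (Set.range fun p => toHecke (parabolicWord p).eval) := by
  set N := Submodule.span R (Set.range fun p => toHecke (parabolicWord p).eval) with hN
  have hL := lineClosed_mem N
  have gen_mem (k : ℤ) (j : Fin 8) : toHecke (a.eval ^ k * (representative j).eval) ∈ N := by
    have base (i : Fin 3) : toHecke (a.eval ^ ((i : ℕ) : ℤ) * (representative j).eval) ∈ N := by
      have : toHecke (parabolicWord (i, j)).eval ∈ N := Submodule.subset_span ⟨(i, j), rfl⟩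
      simpa only [parabolicWord, Word.eval_append, Word.eval_pow] using this
    have := hL.line_a 1 (representative j).eval 0 (by rw [one_mul]; exact base 0)
      (by rw [one_mul]; exact base 1) (by rw [one_mul]; exact base 2) k
    simpa only [one_mul] using this
  -- Left multiplication by s₁ raises the exponent in s₁ ^ i v by one, and all exponents are already
  -- in the span.
  have left_a (x : GenericHecke) (hx : x ∈ N) : toHecke a.eval * x ∈ N := by
    rw [hN] at hx
    induction hx using Submodule.span_induction with
    | mem x hx =>
      obtain ⟨⟨i, j⟩, rfl⟩ := hx
      have := gen_mem ((i : ℕ) + 1) j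
      rw [← map_mul]
      simpa only [parabolicWord, Word.eval_append, Word.eval_pow, ← mul_assoc, zpow_add_one,
        (Commute.self_zpow a.eval ((i : ℕ) : ℤ)).eq] using this
    | zero => rw [mul_zero]; exact zero_mem _
    | add x y _ _ hx hy => rw [mul_add]; exact add_mem hx hy
    | smul r x _ hx => rw [mul_smul_comm]; exact N.smul_mem r hx
  refine ParabolicData.mem hh (.of_representative hL (fun x hx => ?_) fun j => ?_)
  · rw [map_mul]; exact left_a _ hx
  · simpa using gen_mem 0 j

theorem span_parabolicWord :
    Submodule.span R (Set.range fun p => toHecke (parabolicWord p).eval) =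
      Subalgebra.toSubmodule A3 := by
  apply le_antisymm
  · rw [Submodule.span_le]
    rintro _ ⟨p, rfl⟩
    exact toHecke_mem_A3 (parabolicWord_mem p)
  · rw [A3, Algebra.adjoin_eq_span, Submodule.span_le]
    intro x hx
    -- The subalgebra is spanned by the monoid generated by s₁ and s₂, which consists of images of
    -- elements of H.
    suffices H : ∃ h ∈ parabolic, toHecke h = x by
      obtain ⟨h, hh, rfl⟩ := H
      exact toHecke_mem_span_parabolicWord hh
    induction hx using Submonoid.closure_induction with
    | mem x hx =>
      rcases hx with rfl | rfl
      · exact ⟨_, Letter.eval_a_mem, rfl⟩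
      · exact ⟨_, Letter.eval_b_mem, rfl⟩
    | one => exact ⟨1, one_mem _, map_one _⟩
    | mul x y _ _ hx hy =>
      obtain ⟨g, hg, rfl⟩ := hx
      obtain ⟨h, hh, rfl⟩ := hy
      exact ⟨g * h, mul_mem hg hh, map_mul _ _ _⟩

theorem span_cosetWord :
    Submodule.span A3 (Set.range fun p => toHecke (cosetWord p).eval) = ⊤ := by
  set M := Submodule.span A3 (Set.range fun p => toHecke (cosetWord p).eval) with hM
  have hL := lineClosed_mem (M.restrictScalars R)
  have hall : ∀ x, toHecke x ∈ M.restrictScalars R := hL.forall_braid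
    (fun h hh x hx => by
      rw [map_mul]
      exact M.smul_mem ⟨toHecke h, toHecke_mem_A3 hh⟩ hx)
    fun p => Submodule.subset_span ⟨p, rfl⟩
  have : Submodule.span R (Set.range toHecke) ≤ M.restrictScalars R := by
    rw [Submodule.span_le]
    rintro _ ⟨x, rfl⟩
    exact hall x
  rw [eq_top_iff]
  intro x _
  refine this ?_
  rw [toHecke, span_range_ofBraid]
  trivial

theorem span_mul_eq_top {ι κ : Type*} {S : Subalgebra R GenericHecke} {u : ι → GenericHecke}
    {v : κ → GenericHecke} (hu : Submodule.span R (Set.range u) = Subalgebra.toSubmodule S)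
    (hv : Submodule.span S (Set.range v) = ⊤) :
    Submodule.span R (Set.range fun p : ι × κ => u p.1 * v p.2) = ⊤ := by
  set N := Submodule.span R (Set.range fun p : ι × κ => u p.1 * v p.2)
  have key (j : κ) (x : GenericHecke) (hx : x ∈ Submodule.span R (Set.range u)) : x * v j ∈ N := by
    induction hx using Submodule.span_induction with
    | mem x hx =>
      obtain ⟨i, rfl⟩ := hx
      exact Submodule.subset_span ⟨(i, j), rfl⟩
    | zero => rw [zero_mul]; exact zero_mem _
    | add x y _ _ hx hy => rw [add_mul]; exact add_mem hx hy
    | smul r x _ hx => rw [smul_mul_assoc]; exact N.smul_mem r hx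
  rw [eq_top_iff]
  intro x _
  have hx : x ∈ Submodule.span S (Set.range v) := by rw [hv]; trivial
  obtain ⟨c, rfl⟩ := (Finsupp.mem_span_range_iff_exists_finsupp).mp hx
  exact sum_mem fun j _ => key j _ (by rw [hu]; exact (c j).2)

end G26

/-! ### Assembly of the three indexed families -/

theorem mainTheorem2 :
    ∃ (x : Fin 24 → G26.Braid) (y : Fin 54 → G26.Braid) (z : Fin 1296 → G26.Braid),
      x 0 = 1 ∧ y 0 = 1 ∧ z 0 = 1 ∧
      (∀ i, x i ∈ Subgroup.closure {G26.gen G26.Gen.s1, G26.gen G26.Gen.s2}) ∧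
      Set.range z = Set.range (fun p : Fin 24 × Fin 54 => x p.1 * y p.2) ∧
      Submodule.span G26.A3 (Set.range fun j => G26.toHecke (y j)) = ⊤ ∧
      Submodule.span G26.R (Set.range fun i => G26.toHecke (x i)) =
        Subalgebra.toSubmodule G26.A3 ∧
      Submodule.span G26.R (Set.range fun k => G26.toHecke (z k)) = ⊤ := by
  let ex : Fin 24 ≃ Fin 3 × Fin 8 := (finProdFinEquiv (m := 3) (n := 8)).symm
  let ey : Fin 54 ≃ Fin 6 × Fin 9 := (finProdFinEquiv (m := 6) (n := 9)).symm
  let ez : Fin 1296 ≃ Fin 24 × Fin 54 := (finProdFinEquiv (m := 24) (n := 54)).symm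
  let x : Fin 24 → G26.Braid := fun i => (G26.parabolicWord (ex i)).eval
  let y : Fin 54 → G26.Braid := fun j => (G26.cosetWord (ey j)).eval
  have hx : Submodule.span G26.R (Set.range fun i => G26.toHecke (x i)) =
      Subalgebra.toSubmodule G26.A3 := by
    rw [← G26.span_parabolicWord]
    exact congrArg _ (ex.surjective.range_comp fun p => G26.toHecke (G26.parabolicWord p).eval)
  have hy : Submodule.span G26.A3 (Set.range fun j => G26.toHecke (y j)) = ⊤ := by
    rw [← G26.span_cosetWord]
    exact congrArg _ (ey.surjective.range_comp fun p => G26.toHecke (G26.cosetWord p).eval)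
  -- Index 0 stands for exponent 0 and the empty word in both families, so the equations hold by
  -- computation.
  have hx0 : x 0 = 1 := rfl
  have hy0 : y 0 = 1 := rfl
  refine ⟨x, y, fun k => x (ez k).1 * y (ez k).2, hx0, hy0, ?_, fun i => ?_, ?_, hy, hx, ?_⟩
  · have h0 : ez 0 = (0, 0) := rfl
    simp only [h0, hx0, hy0, mul_one]
  · exact G26.parabolicWord_mem _
  · exact ez.surjective.range_comp fun p => x p.1 * y p.2
  · rw [← G26.span_mul_eq_top hx hy]
    simp only [map_mul]
    exact congrArg _ (ez.surjective.range_comp fun p => G26.toHecke (x p.1) * G26.toHecke (y p.2))
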